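/- Let $d\ge 1$ and let $\Omega\subset\mathbb{R}^d$ be a bounded open set (for instance a bounded Lipschitz domain with an interior cone condition). There is a constant $C_P\ge 0$, depending only on $\Omega$, such that the following holds. **Problem.** Let $u\in W_\infty^m(\Omega)$ with $m\ge 2$ be continuous on $\overline\Omega$ and solve the Dirichlet problem $-\Delta u=f$ in $\Omega$ (almost everywhere, with weak second derivatives), $u=g$ on $\partial\Omega$, where $f$ and $g$ are given pointwise. For $v$ of class $C^2$ near $\overline\Omega$ put $\mathcal{L}v=-\Delta v$ in $\Omega$ and $\mathcal{L}v=v$ on $\partial\Omega$. Put $F=f$ in $\Omega$ and $F=g$ on $\partial\Omega$, so that $F=\mathcal{L}u$. Let $u$ be extended in any way to all of $\mathbb{R}^d$. **Discretization.** Let $\Omega_1,\dots,\Omega_P$ be open patches covering $\overline\Omega$, with weight functions $w_j$ that are $C^2$ on $\bigcup_i\Omega_i$, vanish outside $\Omega_j$ and satisfy $\sum_j w_j=1$ on $\overline\Omega$. Let $\phi$ be a radial basis function with $x\mapsto\phi(\|x\|)$ of class $C^2$ on $\mathbb{R}^d$. Let $X=(x_k)_{k=1}^N$ be nodes in $\mathbb{R}^d$,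 let $J_j\subseteq\{1,\dots,N\}$ index the local nodes $X_j=(x_k)_{k\in J_j}$ of patch $j$, and suppose that the matrices $\phi(X_j,X_j)=(\phi(\|x_i-x_k\|))_{i,k\in J_j}$ are nonsingular. Let $\psi(x,X_j)=\phi(x,X_j)\phi(X_j,X_j)^{-1}$ be the row of local cardinal functions $\psi^j_k$, $k\in J_j$. A vector $V\in\mathbb{R}^N$ of nodal values defines the approximation $\sum_j w_j\sum_{k\in J_j}\psi_k^jV_k$. The interpolant $\mathcal{I}(u)$ is the approximation with $V_k=u(x_k)$, and $\mathcal{E}_{\mathcal L}=\mathcal{L}(\mathcal{I}(u)-u)=\mathcal{L}\mathcal{I}(u)-F$. Put $L(x,X)_k=\sum_{j:\,k\in J_j}\mathcal{L}(w_j\psi^j_k)(x)$. For evaluation points $Y=(y_i)_{i=1}^M$ in $\overline\Omega$ let $L=L(Y,X)\in\mathbb{R}^{M\times N}$; assume that $L$ has full column rank, and let $L^+=(L^TL)^{-1}L^T$. The scheme is a *collocation* scheme if the nodes are distinct and lie in $\overline\Omega$, $J_j=\{k: x_k\in\Omega_j\}$, and $Y$ equals $X$ up to ordering. It is a *least squares*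 scheme if each $k$ lies in exactly one $J_j$. **Solution.** Let $U\in\mathbb{R}^N$ be the computed nodal values, $\tilde u$ the approximation with nodal values $U$, and $r=LU-F(Y)$ the residual. Let $C_M,\delta_M\in\mathbb{R}$, where $\delta_M$ stands for the machine precision. Suppose that * the scheme is a collocation scheme and $\|r\|_\infty\le C_M\delta_M$; or * the scheme is a least squares scheme and $L^Tr=0$ holds up to a rounding error $C_M\delta_M$ in the residual, i.e. $L^T(r-e)=0$ for some $e\in\mathbb{R}^M$ with $\|e\|_\infty\le C_M\delta_M$. **Estimate.** Then $$\|\tilde u-u\|_{L_2(\Omega)}\le C_P\|\mathcal{E}_{\mathcal L}\|_\infty+C_P\,\|L(\cdot,X)L^+\|_\infty\,\bigl(C_M\delta_M+\|\mathcal{E}_{\mathcal L}\|_\infty\bigr),$$ where $\|\mathcal{E}_{\mathcal L}\|_\infty=\sup_{x\in\overline\Omega}|\mathcal{E}_{\mathcal L}(x)|$ and $\|L(\cdot,X)L^+\|_\infty=\sup_{x\in\overline\Omega}\sum_{i=1}^M|(L(x,X)L^+)_i|$. Moreover, if the scheme is a least squares scheme and instead $\|L^Tr\|_\infty\le C_M\delta_M$,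 then the same estimate holds with $C_M$ replaced by $\|L(L^TL)^{-1}\|_\infty C_M$, where the matrix norm is the largest absolute row sum. -/

import Mathlib

open MeasureTheory Matrix
open scoped ENNReal NNReal ContDiff

noncomputable section

namespace RBFPUM

/-- Euclidean space `ℝᵈ`. -/
abbrev E (d : ℕ) : Type := EuclideanSpace ℝ (Fin d)

/-- The functions of class `C^∞` with compact support contained in `Ω`. -/
def IsTestFunction {d : ℕ} (Ω : Set (E d)) (η : E d → ℝ) : Prop :=
  ContDiff ℝ ∞ η ∧ HasCompactSupport η ∧ tsupport η ⊆ Ω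

/-- `g` is the weak derivative `∂_{I 0} ⋯ ∂_{I (k-1)} v` on `Ω`. -/
def IsWeakDeriv {d k : ℕ} (Ω : Set (E d)) (v : E d → ℝ) (I : Fin k → Fin d)
    (g : E d → ℝ) : Prop :=
  LocallyIntegrableOn g Ω ∧
  ∀ η : E d → ℝ, IsTestFunction Ω η →
    ∫ x in Ω, v x * iteratedFDeriv ℝ k η x (fun t => EuclideanSpace.single (I t) (1 : ℝ)) =
      (-1) ^ k * ∫ x in Ω, g x * η x

/-- The Sobolev space `W_p^m(Ω)`: all weak partial derivatives of order at most `m` exist and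
lie in `L_p(Ω)` (order `0` says that the function itself does). -/
def MemSobolev {d : ℕ} (m : ℕ) (p : ℝ≥0∞) (Ω : Set (E d)) (v : E d → ℝ) : Prop :=
  ∀ k ≤ m, ∀ I : Fin k → Fin d, ∃ g : E d → ℝ,
    MemLp g p (volume.restrict Ω) ∧ IsWeakDeriv Ω v I g

/-- `u` solves `-Δu = f` in `Ω` (almost everywhere, with weak second derivatives) and `u = g` on
`∂Ω`. As `u` is continuous on the closure of `Ω`, its boundary values are its values on `∂Ω`. -/
structure SolvesPoisson {d : ℕ} (Ω : Set (E d)) (f g u : E d → ℝ) : Prop where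
  continuousOn : ContinuousOn u (closure Ω)
  pde : ∃ D : Fin d → E d → ℝ, (∀ i, IsWeakDeriv Ω u ![i, i] (D i)) ∧
    ∀ᵐ x ∂(volume.restrict Ω), -∑ i, D i x = f x
  boundary : ∀ x ∈ frontier Ω, u x = g x

open Classical in
/-- The operator `𝓛`: `-Δv` in `Ω` and `v` on `∂Ω`, for `v` of class `C²` near `Ω`. -/
def calL {d : ℕ} (Ω : Set (E d)) (v : E d → ℝ) (x : E d) : ℝ :=
  if x ∈ Ω then -(Laplacian.laplacian v : E d → ℝ) x else v x

open Classical in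
/-- The data `F = 𝓛u` of the Poisson problem: `f` in `Ω` and `g` on `∂Ω`. -/
def data {d : ℕ} (Ω : Set (E d)) (f g : E d → ℝ) (x : E d) : ℝ :=
  if x ∈ Ω then f x else g x

/-- The supremum of `|v|` over `Ω ∪ ∂Ω`. -/
def supNorm {d : ℕ} (Ω : Set (E d)) (v : E d → ℝ) : ℝ≥0∞ :=
  ⨆ x ∈ closure Ω, ‖v x‖ₑ

/-- The data of an RBF partition of unity discretization on `Ω`, with `P` patches, `N` nodes and
`M` evaluation points. -/
structure Scheme (d P N M : ℕ) (Ω : Set (E d)) where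
  /-- the patches, an open cover of `Ω ∪ ∂Ω` -/
  patch : Fin P → Set (E d)
  isOpen_patch : ∀ j, IsOpen (patch j)
  cover : closure Ω ⊆ ⋃ j, patch j
  /-- the partition of unity weight functions -/
  w : Fin P → E d → ℝ
  contDiffOn_w : ∀ j, ContDiffOn ℝ 2 (w j) (⋃ i, patch i)
  w_eq_zero : ∀ j, ∀ x, x ∉ patch j → w j x = 0
  sum_w : ∀ x ∈ closure Ω, ∑ j, w j x = 1
  /-- the radial basis function -/
  phi : ℝ → ℝ
  contDiff_phi : ContDiff ℝ 2 (fun x : E d => phi ‖x‖)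
  /-- the nodes; they may lie outside `Ω` -/
  X : Fin N → E d
  /-- the indices of the nodes that belong to patch `j` -/
  J : Fin P → Finset (Fin N)
  /-- the local interpolation matrices `φ(X_j, X_j)` are nonsingular -/
  nonsingular : ∀ j, IsUnit (Matrix.of fun i k : J j => phi ‖X i - X k‖).det
  /-- the evaluation points -/
  Y : Fin M → E d
  Y_mem : ∀ i, Y i ∈ closure Ω

namespace Scheme

variable {d P N M : ℕ} {Ω : Set (E d)} (S : Scheme d P N M Ω)

/-- Collocation: one global set of distinct nodes in `Ω ∪ ∂Ω`, whose points in a patch are the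
local nodes of that patch, and the evaluation points are the nodes. -/
def IsCollocation : Prop :=
  Function.Injective S.X ∧ (∀ k, S.X k ∈ closure Ω) ∧
  (∀ j k, k ∈ S.J j ↔ S.X k ∈ S.patch j) ∧
  ∃ e : Fin M ≃ Fin N, ∀ i, S.Y i = S.X (e i)

/-- Least squares: each patch has its own nodes and its own unknowns, and the global set of
unknowns is the disjoint union of the local ones; the evaluation points are independent of the
nodes. -/
def IsLeastSquares : Prop :=
  ∀ k, ∃! j, k ∈ S.J j

/-- The local interpolation matrix `φ(X_j, X_j)`. -/
def A (j : Fin P) : Matrix (S.J j) (S.J j) ℝ :=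
  Matrix.of fun i k => S.phi ‖S.X i - S.X k‖

/-- The local cardinal functions, `ψ(x, X_j) = φ(x, X_j) φ(X_j, X_j)⁻¹`. -/
def psi (j : Fin P) (x : E d) : S.J j → ℝ :=
  (fun i : S.J j => S.phi ‖x - S.X i‖) ᵥ* (S.A j)⁻¹

/-- The local RBF approximation with nodal values `V` on patch `j`. -/
def localApprox (V : Fin N → ℝ) (j : Fin P) (x : E d) : ℝ :=
  ∑ k : S.J j, S.psi j x k * V k

/-- The global RBF-PUM approximation with nodal values `V`. -/
def approx (V : Fin N → ℝ) (x : E d) : ℝ :=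
  ∑ j, S.w j x * S.localApprox V j x

/-- The RBF-PUM interpolant of `u`. -/
def interp (u : E d → ℝ) : E d → ℝ :=
  S.approx fun k => u (S.X k)

/-- The row vector `L(x, X)`, assembled patch by patch from `𝓛(w_j(x) φ(x, X_j)) φ(X_j, X_j)⁻¹`. -/
def Lrow (x : E d) (k : Fin N) : ℝ :=
  ∑ j, if h : k ∈ S.J j then calL Ω (fun y => S.w j y * S.psi j y ⟨k, h⟩) x else 0

/-- The global matrix `L = L(Y, X)`. -/
def L : Matrix (Fin M) (Fin N) ℝ :=
  Matrix.of fun i k => S.Lrow (S.Y i) k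

/-- The pseudo-inverse `L⁺ = (LᵀL)⁻¹Lᵀ`, for `L` of full column rank. -/
def Lplus : Matrix (Fin N) (Fin M) ℝ :=
  (S.Lᵀ * S.L)⁻¹ * S.Lᵀ

/-- The residual `r_U = L U - F(Y)`. -/
def residual (f g : E d → ℝ) (U : Fin N → ℝ) : Fin M → ℝ :=
  fun i => (S.L *ᵥ U) i - data Ω f g (S.Y i)

/-- The error `𝓔 = 𝓛(I(u) - u) = 𝓛(I(u)) - F` of the interpolant under the operator `𝓛`, where
`F = 𝓛u` is the data of the problem that `u` solves. -/
def interpError (f g u : E d → ℝ) (x : E d) : ℝ :=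
  calL Ω (S.interp u) x - data Ω f g x

/-- The stability norm `‖L(·, X) L⁺‖_∞`, the norm of `r ↦ L(·, X) L⁺ r` as an operator from `ℝᴹ`
with the maximum norm to functions on `Ω ∪ ∂Ω` with the supremum norm. -/
def stabilityNorm : ℝ≥0∞ :=
  ⨆ x ∈ closure Ω, ∑ i, ‖(S.Lrow x ᵥ* S.Lplus) i‖ₑ

/-- The right-hand side of the error estimate, with rounding error `τ`. -/
def errorBound (CP : ℝ≥0) (f g u : E d → ℝ) (τ : ℝ) : ℝ≥0∞ :=
  CP * supNorm Ω (S.interpError f g u) +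
    CP * S.stabilityNorm * (ENNReal.ofReal τ + supNorm Ω (S.interpError f g u))

end Scheme

/-- The relation `Aᵀ r = 0` holds up to a rounding error of size `τ` in the vector `r`
(`‖·‖` on `ℝᴹ` is the maximum norm). -/
def OrthogonalUpTo {M N : ℕ} (A : Matrix (Fin M) (Fin N) ℝ) (r : Fin M → ℝ) (τ : ℝ) : Prop :=
  ∃ e : Fin M → ℝ, ‖e‖ ≤ τ ∧ Aᵀ *ᵥ (r - e) = 0

/-- The matrix norm induced by the maximum norms: the largest absolute row sum. -/
def rowSumNorm {M N : ℕ} (A : Matrix (Fin M) (Fin N) ℝ) : ℝ≥0 :=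
  Finset.univ.sup fun i => ∑ k, ‖A i k‖₊

end RBFPUM

end

/-!
Let `V` be the vector of nodal values of `u`. The residuals of `U` and `V` differ by `L (U - V)`,
and the residual of `V` consists of values of the interpolation error `𝓔`. As `L⁺ L = 1` and `L⁺ r`
sees only the rounding error in `r`, the vector `U - V` is `L⁺` applied to rounding and
interpolation errors, so `𝓛 ũ - F` is bounded by `‖𝓔‖ + ‖L(·, X) L⁺‖ (CM δM + ‖𝓔‖)`.

It remains to bound `ũ - u`, which has a bounded weak Laplacian and bounded boundary values, by the
same quantity. A function with positive weak Laplacian becomes, after mollification, a `C²` function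
with positive Laplacian, which has no interior maximum; barriers `a‖·‖²` then yield a bound in the
supremum norm for arbitrary bounded open sets, and hence in every `L_p` norm.
-/

namespace RBFPUM

open Metric Set Filter
open scoped Laplacian Topology Convolution

section SecondDerivatives

variable {F : Type*} [NormedAddCommGroup F] [NormedSpace ℝ F]

theorem contDiffAt_fderiv_apply {v : F → ℝ} {x : F} {n m : WithTop ℕ∞}
    (hv : ContDiffAt ℝ n v x) (hmn : m + 1 ≤ n) (e : F) :
    ContDiffAt ℝ m (fun y => fderiv ℝ v y e) x :=
  (hv.fderiv_right hmn).clm_apply contDiffAt_const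

theorem fderiv_fderiv_apply {v : F → ℝ} {x : F} (hv : ContDiffAt ℝ 2 v x) (e e' : F) :
    fderiv ℝ (fun y => fderiv ℝ v y e) x e' = fderiv ℝ (fderiv ℝ v) x e' e := by
  have hdiff : DifferentiableAt ℝ (fderiv ℝ v) x :=
    (hv.fderiv_right (m := 1) (by norm_num)).differentiableAt one_ne_zero
  simp [fderiv_clm_apply hdiff (differentiableAt_const e)]

theorem fderiv_comp_const_sub (v : F → ℝ) (a x : F) :
    fderiv ℝ (fun y => v (a - y)) x = -fderiv ℝ v (a - x) := by
  have hcomp : (fun y => v (a - y)) =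
      (fun z => v (a + z)) ∘ ContinuousLinearEquiv.neg ℝ (M := F) := by
    ext y
    simp [sub_eq_add_neg]
  rw [hcomp, ContinuousLinearEquiv.comp_right_fderiv, fderiv_comp_add_left]
  ext y
  simp [sub_eq_add_neg]

theorem deriv_deriv_nonpos_of_isLocalMax {f : ℝ → ℝ} {x : ℝ} (hf : ContinuousAt f x)
    (hmax : IsLocalMax f x) : deriv (deriv f) x ≤ 0 := by
  by_contra! hpos
  have hmin : IsLocalMin f x := isLocalMin_of_deriv_deriv_pos hpos hmax.deriv_eq_zero hf
  have hconst : f =ᶠ[𝓝 x] fun _ => f x := by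
    filter_upwards [hmax, hmin] with y h₁ h₂ using le_antisymm h₁ h₂
  simp [hconst.deriv.deriv_eq] at hpos

theorem fderiv_fderiv_apply_nonpos_of_isLocalMax {v : F → ℝ} {x : F} (hv : ContDiffAt ℝ 2 v x)
    (hmax : IsLocalMax v x) (e : F) : fderiv ℝ (fun y => fderiv ℝ v y e) x e ≤ 0 := by
  have hline (t : ℝ) : HasDerivAt (fun t : ℝ => x + t • e) e t := by
    simpa using ((hasDerivAt_id t).smul_const e).const_add x
  have htendsto : Tendsto (fun t : ℝ => x + t • e) (𝓝 0) (𝓝 x) := by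
    simpa using (hline 0).continuousAt.tendsto
  have hderiv : deriv (fun t : ℝ => v (x + t • e)) =ᶠ[𝓝 0]
      fun t => fderiv ℝ v (x + t • e) e := by
    filter_upwards [htendsto.eventually (hv.eventually (by simp))] with t ht
    exact ((ht.differentiableAt two_ne_zero).hasFDerivAt.comp_hasDerivAt t (hline t)).deriv
  have hderiv₂ : deriv (deriv fun t : ℝ => v (x + t • e)) 0 =
      fderiv ℝ (fun y => fderiv ℝ v y e) x e := by
    have hd := (contDiffAt_fderiv_apply (m := 1) hv (by norm_num) e).differentiableAt one_ne_zero
    rw [hderiv.deriv_eq]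
    exact (hd.hasFDerivAt.comp_hasDerivAt_of_eq 0 (hline 0) (by simp)).deriv
  rw [← hderiv₂]
  refine deriv_deriv_nonpos_of_isLocalMax ?_ ?_
  · exact (hv.continuousAt.comp_of_eq (hline 0).continuousAt (by simp))
  · filter_upwards [htendsto.eventually hmax] with t ht
    simpa using ht

end SecondDerivatives

section Laplacian

variable {F : Type*} [NormedAddCommGroup F] [InnerProductSpace ℝ F] [FiniteDimensional ℝ F]

theorem laplacian_eq_sum_fderiv_fderiv {ι : Type*} [Fintype ι] {v : F → ℝ} {x : F}
    (hv : ContDiffAt ℝ 2 v x) (b : OrthonormalBasis ι ℝ F) :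
    Δ v x = ∑ i, fderiv ℝ (fun y => fderiv ℝ v y (b i)) x (b i) := by
  simp [InnerProductSpace.laplacian_eq_iteratedFDeriv_orthonormalBasis v b,
    iteratedFDeriv_two_apply, fderiv_fderiv_apply hv]

theorem continuousAt_laplacian {v : F → ℝ} {x : F} (hv : ContDiffAt ℝ 2 v x) :
    ContinuousAt (Δ v) x := by
  have hcont := hv.continuousAt_iteratedFDeriv (k := 2) le_rfl
  have hterm (e : F) : ContinuousAt (fun y => iteratedFDeriv ℝ 2 v y ![e, e]) x :=
    (ContinuousMultilinearMap.apply ℝ (fun _ : Fin 2 => F) ℝ ![e, e]).continuous.continuousAt.comp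
      hcont
  rw [InnerProductSpace.laplacian_eq_iteratedFDeriv_stdOrthonormalBasis]
  exact tendsto_finsetSum _ fun i _ => hterm _

theorem tsupport_laplacian_subset (v : F → ℝ) : tsupport (Δ v) ⊆ tsupport v := by
  refine closure_minimal (fun x hx => ?_) (isClosed_tsupport v)
  contrapose! hx
  have hzero : v =ᶠ[𝓝 x] fun _ => 0 := notMem_tsupport_iff_eventuallyEq.1 hx
  simp [(InnerProductSpace.laplacian_congr_nhds hzero).eq_of_nhds]

theorem laplacian_sum {ι : Type*} {s : Finset ι} {v : ι → F → ℝ} {x : F}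
    (hv : ∀ i ∈ s, ContDiffAt ℝ 2 (v i) x) : Δ (∑ i ∈ s, v i) x = ∑ i ∈ s, Δ (v i) x := by
  simp only [InnerProductSpace.laplacian_eq_iteratedFDeriv_stdOrthonormalBasis]
  rw [iteratedFDeriv_sum_apply hv, Finset.sum_comm]
  simp only [_root_.sum_apply]

theorem laplacian_comp_const_sub {v : F → ℝ} {x t : F} (hv : ContDiff ℝ 2 v) :
    Δ (fun y => v (x - y)) t = Δ v (x - t) := by
  have hcomp : ContDiff ℝ 2 fun y => v (x - y) := hv.comp (contDiff_const.sub contDiff_id)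
  let b := stdOrthonormalBasis ℝ F
  rw [laplacian_eq_sum_fderiv_fderiv hcomp.contDiffAt b,
    laplacian_eq_sum_fderiv_fderiv hv.contDiffAt b]
  refine Finset.sum_congr rfl fun i _ => ?_
  simp only [fderiv_comp_const_sub, _root_.neg_apply, fderiv_fun_neg,
    fderiv_comp_const_sub (fun y => fderiv ℝ v y (b i)), neg_neg]

theorem laplacian_norm_sq (x : F) :
    Δ (fun y : F => ‖y‖ ^ 2) x = 2 * Module.finrank ℝ F := by
  let b := stdOrthonormalBasis ℝ F
  rw [laplacian_eq_sum_fderiv_fderiv (contDiff_norm_sq ℝ).contDiffAt b]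
  have hfderiv (i) : (fun y => fderiv ℝ (fun z : F => ‖z‖ ^ 2) y (b i)) =
      fun y => 2 * inner ℝ (b i) y := by
    funext y
    simp [fderiv_norm_sq_apply, real_inner_comm]
  have hfderiv₂ (i) : fderiv ℝ (fun y => 2 * inner ℝ (b i) y) x (b i) = 2 := by
    have h := ((innerSL ℝ (b i)).hasFDerivAt (x := x)).const_mul 2
    simpa using DFunLike.congr_fun h.fderiv (b i)
  simp only [hfderiv, hfderiv₂]
  simp [mul_comm]

theorem laplacian_nonpos_of_isLocalMax {v : F → ℝ} {x : F} (hv : ContDiffAt ℝ 2 v x)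
    (hmax : IsLocalMax v x) : Δ v x ≤ 0 := by
  rw [laplacian_eq_sum_fderiv_fderiv hv (stdOrthonormalBasis ℝ F)]
  exact Finset.sum_nonpos fun i _ => fderiv_fderiv_apply_nonpos_of_isLocalMax hv hmax _

end Laplacian

section IntegrationByParts

theorem integrable_mul_of_tsupport_subset {X : Type*} [TopologicalSpace X] [MeasurableSpace X]
    [OpensMeasurableSpace X] [T2Space X] {μ : Measure X} {s : Set X} {h b : X → ℝ}
    (hh : LocallyIntegrableOn h s μ) (hb : Continuous b) (hbc : HasCompactSupport b)
    (hbs : tsupport b ⊆ s) : Integrable (fun x => h x * b x) μ := by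
  have hint : IntegrableOn (fun x => h x * b x) (tsupport b) μ :=
    (hh.integrableOn_compact_subset hbs hbc).mul_continuousOn hb.continuousOn hbc
  refine (integrableOn_iff_integrable_of_support_subset ?_).1 hint
  exact (Function.support_mul_subset_right h b).trans (subset_tsupport b)

variable {F : Type*} [NormedAddCommGroup F] [NormedSpace ℝ F] [FiniteDimensional ℝ F]
  [MeasurableSpace F] [BorelSpace F] {μ : Measure F} [μ.IsAddHaarMeasure] {Ω : Set F}

theorem integral_mul_fderiv_eq_neg_fderiv_mul_of_tsupport_subset {a b : F → ℝ} (hΩ : IsOpen Ω)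
    (ha : ContDiffOn ℝ 1 a Ω) (hb : ContDiff ℝ 1 b) (hbc : HasCompactSupport b)
    (hbs : tsupport b ⊆ Ω) (e : F) :
    ∫ x, a x * fderiv ℝ b x e ∂μ = -∫ x, fderiv ℝ a x e * b x ∂μ := by
  have ha_loc : LocallyIntegrableOn a Ω μ := ha.continuousOn.locallyIntegrableOn hΩ.measurableSet
  have ha'_loc : LocallyIntegrableOn (fun x => fderiv ℝ a x e) Ω μ :=
    ((ha.continuousOn_fderiv_of_isOpen hΩ le_rfl).clm_apply
      continuousOn_const).locallyIntegrableOn hΩ.measurableSet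
  refine integral_mul_fderiv_eq_neg_fderiv_mul_of_integrable
    (integrable_mul_of_tsupport_subset ha'_loc hb.continuous hbc hbs)
    (integrable_mul_of_tsupport_subset ha_loc
      ((hb.continuous_fderiv one_ne_zero).clm_apply continuous_const)
      (hbc.fderiv_apply ℝ e) ((tsupport_fderiv_apply_subset ℝ e).trans hbs))
    (integrable_mul_of_tsupport_subset ha_loc hb.continuous hbc hbs)
    (fun x hx => ?_) (fun x _ => hb.differentiable one_ne_zero x)
  exact (ha.differentiableOn one_ne_zero).differentiableAt (hΩ.mem_nhds (hbs hx))

theorem integral_mul_fderiv_fderiv_eq {a b : F → ℝ} (hΩ : IsOpen Ω)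
    (ha : ContDiffOn ℝ 2 a Ω) (hb : ContDiff ℝ 2 b) (hbc : HasCompactSupport b)
    (hbs : tsupport b ⊆ Ω) (e : F) :
    ∫ x, a x * fderiv ℝ (fun y => fderiv ℝ b y e) x e ∂μ =
      ∫ x, fderiv ℝ (fun y => fderiv ℝ a y e) x e * b x ∂μ := by
  have ha' : ContDiffOn ℝ 1 (fun y => fderiv ℝ a y e) Ω :=
    (ha.fderiv_of_isOpen hΩ (by norm_num)).clm_apply contDiffOn_const
  have hb' : ContDiff ℝ 1 fun y => fderiv ℝ b y e :=
    (hb.fderiv_right (by norm_num)).clm_apply contDiff_const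
  rw [integral_mul_fderiv_eq_neg_fderiv_mul_of_tsupport_subset hΩ (ha.of_le one_le_two) hb'
      (hbc.fderiv_apply ℝ e) ((tsupport_fderiv_apply_subset ℝ e).trans hbs),
    integral_mul_fderiv_eq_neg_fderiv_mul_of_tsupport_subset hΩ ha' (hb.of_le one_le_two) hbc hbs,
    neg_neg]

end IntegrationByParts

section WeakLaplacian

variable {F : Type*} [NormedAddCommGroup F] [InnerProductSpace ℝ F] [FiniteDimensional ℝ F]
  [MeasurableSpace F] [BorelSpace F] {Ω : Set F}

theorem integral_mul_laplacian_eq {a b : F → ℝ} (hΩ : IsOpen Ω) (ha : ContDiffOn ℝ 2 a Ω)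
    (hb : ContDiff ℝ 2 b) (hbc : HasCompactSupport b) (hbs : tsupport b ⊆ Ω) :
    ∫ x, a x * Δ b x = ∫ x, Δ a x * b x := by
  let e := stdOrthonormalBasis ℝ F
  have hb' (i) : ContDiff ℝ 1 fun y => fderiv ℝ b y (e i) :=
    (hb.fderiv_right (by norm_num)).clm_apply contDiff_const
  have ha' (i) : ContDiffOn ℝ 1 (fun y => fderiv ℝ a y (e i)) Ω :=
    (ha.fderiv_of_isOpen hΩ (by norm_num)).clm_apply contDiffOn_const
  have ha''_loc (i) : LocallyIntegrableOn
      (fun x => fderiv ℝ (fun y => fderiv ℝ a y (e i)) x (e i)) Ω :=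
    (((ha' i).continuousOn_fderiv_of_isOpen hΩ le_rfl).clm_apply
      continuousOn_const).locallyIntegrableOn hΩ.measurableSet
  calc ∫ x, a x * Δ b x
      = ∫ x, ∑ i, a x * fderiv ℝ (fun y => fderiv ℝ b y (e i)) x (e i) := by
        simp only [laplacian_eq_sum_fderiv_fderiv hb.contDiffAt e, Finset.mul_sum]
    _ = ∑ i, ∫ x, a x * fderiv ℝ (fun y => fderiv ℝ b y (e i)) x (e i) :=
        integral_finsetSum _ fun i _ => integrable_mul_of_tsupport_subset
          (ha.continuousOn.locallyIntegrableOn hΩ.measurableSet)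
          (((hb' i).continuous_fderiv one_ne_zero).clm_apply continuous_const)
          ((hbc.fderiv_apply ℝ (e i)).fderiv_apply ℝ (e i))
          (((tsupport_fderiv_apply_subset ℝ (e i)).trans
            (tsupport_fderiv_apply_subset ℝ (e i))).trans hbs)
    _ = ∑ i, ∫ x, fderiv ℝ (fun y => fderiv ℝ a y (e i)) x (e i) * b x := by
        simp only [integral_mul_fderiv_fderiv_eq hΩ ha hb hbc hbs]
    _ = ∫ x, ∑ i, fderiv ℝ (fun y => fderiv ℝ a y (e i)) x (e i) * b x :=
        (integral_finsetSum _ fun i _ =>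
          integrable_mul_of_tsupport_subset (ha''_loc i) hb.continuous hbc hbs).symm
    _ = ∫ x, Δ a x * b x := by
        refine integral_congr_ae (.of_forall fun x => ?_)
        by_cases hx : x ∈ Ω
        · simp only [laplacian_eq_sum_fderiv_fderiv (ha.contDiffAt (hΩ.mem_nhds hx)) e,
            Finset.sum_mul]
        · simp [image_eq_zero_of_notMem_tsupport fun h => hx (hbs h)]

/-- `h` is the distributional Laplacian of `z` on `Ω`: the only information on the solution of the
Poisson problem that the maximum principle needs. The integrals extend over the whole space, which
is harmless as test functions vanish outside `Ω`. -/
structure HasWeakLaplacian (Ω : Set F) (z h : F → ℝ) : Prop where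
  locallyIntegrableOn_left : LocallyIntegrableOn z Ω
  locallyIntegrableOn_right : LocallyIntegrableOn h Ω
  integral_eq : ∀ η : F → ℝ, ContDiff ℝ ∞ η → HasCompactSupport η → tsupport η ⊆ Ω →
    ∫ x, z x * Δ η x = ∫ x, h x * η x

theorem integrable_mul_laplacian_of_tsupport_subset {z η : F → ℝ} (hz : LocallyIntegrableOn z Ω)
    (hη : ContDiff ℝ 2 η) (hηc : HasCompactSupport η) (hηs : tsupport η ⊆ Ω) :
    Integrable fun x => z x * Δ η x :=
  integrable_mul_of_tsupport_subset hz
    (continuous_iff_continuousAt.2 fun _ => continuousAt_laplacian hη.contDiffAt)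
    (hηc.of_isClosed_subset (isClosed_tsupport _) (tsupport_laplacian_subset η))
    ((tsupport_laplacian_subset η).trans hηs)

namespace HasWeakLaplacian

variable {z h z' h' : F → ℝ}

theorem of_contDiffOn (hΩ : IsOpen Ω) (hz : ContDiffOn ℝ 2 z Ω) : HasWeakLaplacian Ω z (Δ z) where
  locallyIntegrableOn_left := hz.continuousOn.locallyIntegrableOn hΩ.measurableSet
  locallyIntegrableOn_right := ContinuousOn.locallyIntegrableOn (fun _ hx =>
    (continuousAt_laplacian (hz.contDiffAt (hΩ.mem_nhds hx))).continuousWithinAt) hΩ.measurableSet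
  integral_eq _ hη := integral_mul_laplacian_eq hΩ hz (contDiff_infty.1 hη 2)

theorem add (H : HasWeakLaplacian Ω z h) (H' : HasWeakLaplacian Ω z' h') :
    HasWeakLaplacian Ω (z + z') (h + h') where
  locallyIntegrableOn_left := H.locallyIntegrableOn_left.add H'.locallyIntegrableOn_left
  locallyIntegrableOn_right := H.locallyIntegrableOn_right.add H'.locallyIntegrableOn_right
  integral_eq η hη hηc hηs := by
    have hη₂ : ContDiff ℝ 2 η := contDiff_infty.1 hη 2
    simp only [Pi.add_apply, add_mul]
    rw [integral_add, integral_add, H.integral_eq η hη hηc hηs, H'.integral_eq η hη hηc hηs]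
    · exact integrable_mul_of_tsupport_subset H.locallyIntegrableOn_right hη.continuous hηc hηs
    · exact integrable_mul_of_tsupport_subset H'.locallyIntegrableOn_right hη.continuous hηc hηs
    · exact integrable_mul_laplacian_of_tsupport_subset H.locallyIntegrableOn_left hη₂ hηc hηs
    · exact integrable_mul_laplacian_of_tsupport_subset H'.locallyIntegrableOn_left hη₂ hηc hηs

theorem neg (H : HasWeakLaplacian Ω z h) : HasWeakLaplacian Ω (-z) (-h) where
  locallyIntegrableOn_left := H.locallyIntegrableOn_left.neg
  locallyIntegrableOn_right := H.locallyIntegrableOn_right.neg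
  integral_eq η hη hηc hηs := by
    simp only [Pi.neg_apply, neg_mul, integral_neg, H.integral_eq η hη hηc hηs]

theorem sub (H : HasWeakLaplacian Ω z h) (H' : HasWeakLaplacian Ω z' h') :
    HasWeakLaplacian Ω (z - z') (h - h') := by
  simpa only [sub_eq_add_neg] using H.add H'.neg

end HasWeakLaplacian

end WeakLaplacian

section Mollification

theorem fderiv_convolution_apply {F : Type*} [NormedAddCommGroup F] [NormedSpace ℝ F]
    [MeasurableSpace F] [BorelSpace F] {μ : Measure F} [SFinite μ] [μ.IsAddLeftInvariant]
    {g ψ : F → ℝ} (hg : LocallyIntegrable g μ) (hψ : ContDiff ℝ 1 ψ) (hψc : HasCompactSupport ψ)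
    (e x : F) :
    fderiv ℝ (g ⋆[.mul ℝ ℝ, μ] ψ) x e = (g ⋆[.mul ℝ ℝ, μ] fun y => fderiv ℝ ψ y e) x := by
  have hderiv := hψc.hasFDerivAt_convolution_right (.mul ℝ ℝ) hg hψ x
  rw [hderiv.fderiv]
  exact convolution_precompR_apply (.mul ℝ ℝ) hg (hψc.fderiv ℝ)
    (hψ.continuous_fderiv one_ne_zero) x e

variable {F : Type*} [NormedAddCommGroup F] [InnerProductSpace ℝ F] [FiniteDimensional ℝ F]
  [MeasurableSpace F] [BorelSpace F] {Ω : Set F} {z h g ψ : F → ℝ} {c : ℝ}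

theorem laplacian_convolution {μ : Measure F} [SFinite μ] [μ.IsAddLeftInvariant]
    (hg : LocallyIntegrable g μ) (hψ : ContDiff ℝ 2 ψ) (hψc : HasCompactSupport ψ) (x : F) :
    Δ (g ⋆[.mul ℝ ℝ, μ] ψ) x = ∫ t, g t * Δ ψ (x - t) ∂μ := by
  let e := stdOrthonormalBasis ℝ F
  have hψ' (i) : ContDiff ℝ 1 fun y => fderiv ℝ ψ y (e i) :=
    (hψ.fderiv_right (by norm_num)).clm_apply contDiff_const
  have hψ'c (i) : HasCompactSupport fun y => fderiv ℝ ψ y (e i) := hψc.fderiv_apply ℝ (e i)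
  have hfirst (i) : (fun y => fderiv ℝ (g ⋆[.mul ℝ ℝ, μ] ψ) y (e i)) =
      g ⋆[.mul ℝ ℝ, μ] fun y => fderiv ℝ ψ y (e i) :=
    funext (fderiv_convolution_apply hg (hψ.of_le one_le_two) hψc (e i))
  have hconv : ContDiffAt ℝ 2 (g ⋆[.mul ℝ ℝ, μ] ψ) x :=
    (hψc.contDiff_convolution_right (n := 2) (.mul ℝ ℝ) hg hψ).contDiffAt
  calc Δ (g ⋆[.mul ℝ ℝ, μ] ψ) x
      = ∑ i, ∫ t, g t * fderiv ℝ (fun y => fderiv ℝ ψ y (e i)) (x - t) (e i) ∂μ := by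
        simp only [laplacian_eq_sum_fderiv_fderiv hconv e, hfirst,
          fderiv_convolution_apply hg (hψ' _) (hψ'c _)]
        rfl
    _ = ∫ t, ∑ i, g t * fderiv ℝ (fun y => fderiv ℝ ψ y (e i)) (x - t) (e i) ∂μ :=
        (integral_finsetSum _ fun i _ => ((hψ'c i).fderiv_apply ℝ (e i)).convolutionExists_right
          (.mul ℝ ℝ) hg (((hψ' i).continuous_fderiv one_ne_zero).clm_apply continuous_const) x).symm
    _ = ∫ t, g t * Δ ψ (x - t) ∂μ := by
        simp only [laplacian_eq_sum_fderiv_fderiv hψ.contDiffAt e, Finset.mul_sum]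

theorem HasWeakLaplacian.laplacian_convolution_eq (H : HasWeakLaplacian Ω z h)
    (hg : LocallyIntegrable g) (hψ : ContDiff ℝ ∞ ψ) (hψc : HasCompactSupport ψ) {x : F}
    (hs : tsupport (fun t => ψ (x - t)) ⊆ Ω) (hgz : EqOn g z (tsupport fun t => ψ (x - t))) :
    Δ (g ⋆[.mul ℝ ℝ] ψ) x = ∫ t, h t * ψ (x - t) := by
  have hψ₂ : ContDiff ℝ 2 ψ := contDiff_infty.1 hψ 2
  rw [laplacian_convolution hg hψ₂ hψc, ← H.integral_eq (fun t => ψ (x - t))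
    (hψ.comp (contDiff_const.sub contDiff_id))
    (hψc.comp_homeomorph (Homeomorph.subLeft x)) hs]
  refine integral_congr_ae (.of_forall fun t => ?_)
  simp only [← laplacian_comp_const_sub hψ₂]
  by_cases ht : t ∈ tsupport fun t => ψ (x - t)
  · exact congrArg (· * _) (hgz ht)
  · have hzero : Δ (fun y => ψ (x - y)) t = 0 :=
      image_eq_zero_of_notMem_tsupport fun hmem => ht (tsupport_laplacian_subset _ hmem)
    rw [hzero, mul_zero, mul_zero]

theorem le_integral_mul_of_ae_le {X : Type*} [TopologicalSpace X] [MeasurableSpace X]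
    [OpensMeasurableSpace X] [T2Space X] {μ : Measure X} {s : Set X} {f b : X → ℝ}
    (hs : MeasurableSet s) (hf : LocallyIntegrableOn f s μ)
    (hcf : ∀ᵐ x ∂μ.restrict s, c ≤ f x) (hb : Continuous b) (hbc : HasCompactSupport b)
    (hbs : tsupport b ⊆ s) (hb_nonneg : ∀ x, 0 ≤ b x) (hb_int : ∫ x, b x ∂μ = 1) :
    c ≤ ∫ x, f x * b x ∂μ := by
  calc c = ∫ x, c * b x ∂μ := by rw [integral_const_mul, hb_int, mul_one]
    _ ≤ ∫ x, f x * b x ∂μ := by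
      refine integral_mono_ae ((integrable_of_integral_eq_one hb_int).const_mul c)
        (integrable_mul_of_tsupport_subset hf hb hbc hbs) ?_
      filter_upwards [(ae_restrict_iff' hs).1 hcf] with x hx
      by_cases hxs : x ∈ s
      · exact mul_le_mul_of_nonneg_right (hx hxs) (hb_nonneg x)
      · simp [image_eq_zero_of_notMem_tsupport fun h => hxs (hbs h)]

theorem tsupport_normed_const_sub (φ : ContDiffBump (0 : F)) (x : F) :
    tsupport (fun t => φ.normed volume (x - t)) = closedBall x φ.rOut := by
  have hpre : tsupport (fun t => φ.normed volume (x - t)) =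
      Homeomorph.subLeft x ⁻¹' tsupport (φ.normed volume) :=
    tsupport_comp_eq_preimage (φ.normed volume) (Homeomorph.subLeft x)
  ext t
  simp [hpre, φ.tsupport_normed_eq, dist_eq_norm, norm_sub_rev]

theorem HasWeakLaplacian.exists_contDiff_approx {K : Set F} {γ : ℝ} (H : HasWeakLaplacian Ω z h)
    (hΩ : IsOpen Ω) (hz : ContinuousOn z Ω) (hch : ∀ᵐ x ∂volume.restrict Ω, c ≤ h x)
    (hK : IsCompact K) (hKΩ : K ⊆ Ω) (hγ : 0 < γ) :
    ∃ G : F → ℝ, ContDiff ℝ 2 G ∧ ∀ x ∈ K, |G x - z x| ≤ γ ∧ c ≤ Δ G x := by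
  obtain ⟨δ, hδ, hδΩ⟩ := hK.exists_cthickening_subset_open hΩ hKΩ
  have hB : IsCompact (cthickening δ K) := hK.cthickening
  have hzB : ContinuousOn z (cthickening δ K) := hz.mono hδΩ
  obtain ⟨ρ, hρ, hunif⟩ := uniformContinuousOn_iff_le.1
    (hB.uniformContinuousOn_of_continuous hzB) γ hγ
  let φ : ContDiffBump (0 : F) := ⟨min δ ρ / 2, min δ ρ, by positivity, by
    linarith [lt_min hδ hρ]⟩
  let g : F → ℝ := (cthickening δ K).indicator z
  have hg : Integrable g :=
    (integrable_indicator_iff hB.measurableSet).2 (hzB.integrableOn_compact hB)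
  have hball {x} (hx : x ∈ K) : closedBall x φ.rOut ⊆ cthickening δ K :=
    (closedBall_subset_closedBall (min_le_left _ _)).trans (closedBall_subset_cthickening hx δ)
  have hgz : EqOn g z (cthickening δ K) := fun x hx => indicator_of_mem hx z
  have hψ : ContDiff ℝ ∞ (φ.normed volume) := φ.contDiff_normed
  refine ⟨g ⋆[.mul ℝ ℝ] φ.normed volume, φ.hasCompactSupport_normed.contDiff_convolution_right
    (n := 2) (.mul ℝ ℝ) hg.locallyIntegrable (contDiff_infty.1 hψ 2), fun x hx => ⟨?_, ?_⟩⟩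
  · have hxB : x ∈ cthickening δ K := self_subset_cthickening K hx
    have hdist := φ.dist_normed_convolution_le (x₀ := x) (ε := γ) hg.aestronglyMeasurable
      fun y hy => by
        have hyB := hball hx (ball_subset_closedBall hy)
        rw [hgz hyB, hgz hxB]
        exact hunif y hyB x hxB ((mem_ball.1 hy).le.trans (min_le_right _ _))
    rw [← convolution_flip, Real.dist_eq, hgz hxB] at hdist
    have hflip : (ContinuousLinearMap.lsmul ℝ ℝ : ℝ →L[ℝ] ℝ →L[ℝ] ℝ).flip = .mul ℝ ℝ :=
      ContinuousLinearMap.ext fun a => ContinuousLinearMap.ext fun b => mul_comm b a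
    rwa [hflip] at hdist
  · have htsupp := tsupport_normed_const_sub φ x
    rw [H.laplacian_convolution_eq hg.locallyIntegrable hψ φ.hasCompactSupport_normed
      (htsupp ▸ (hball hx).trans hδΩ) (htsupp ▸ hgz.mono (hball hx))]
    refine le_integral_mul_of_ae_le hΩ.measurableSet H.locallyIntegrableOn_right hch
      (φ.continuous_normed.comp (continuous_const.sub continuous_id))
      (φ.hasCompactSupport_normed.comp_homeomorph (Homeomorph.subLeft x))
      (htsupp ▸ (hball hx).trans hδΩ) (fun t => φ.nonneg_normed _) ?_
    rw [integral_sub_left_eq_self (φ.normed volume), φ.integral_normed]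

end Mollification

section MaximumPrinciple

variable {F : Type*} [NormedAddCommGroup F] [InnerProductSpace ℝ F] [FiniteDimensional ℝ F]
  [MeasurableSpace F] [BorelSpace F] {Ω : Set F} {z h : F → ℝ} {m c K R : ℝ} {x : F}

namespace HasWeakLaplacian

/- If `z x > m`, a `C²` function with positive Laplacian is so close to `z` on a compact subset of
`Ω` that its maximum over this subset is an interior one. -/
theorem le_of_forall_frontier_le_of_pos (H : HasWeakLaplacian Ω z h) (hΩ : IsOpen Ω)
    (hΩb : Bornology.IsBounded Ω) (hz : ContinuousOn z (closure Ω)) (hc : 0 < c)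
    (hch : ∀ᵐ y ∂volume.restrict Ω, c ≤ h y) (hm : ∀ y ∈ frontier Ω, z y ≤ m)
    (hx : x ∈ closure Ω) : z x ≤ m := by
  by_contra! hmx
  obtain ⟨γ, hγ, hγx⟩ : ∃ γ > 0, m + 3 * γ < z x := ⟨(z x - m) / 4, by linarith, by linarith⟩
  let K := closure Ω ∩ z ⁻¹' Ici (m + γ)
  have hK : IsCompact K := hΩb.isCompact_closure.of_isClosed_subset
    (hz.preimage_isClosed_of_isClosed isClosed_closure isClosed_Ici) inter_subset_left
  have hKΩ : K ⊆ Ω := fun y ⟨hy, hzy⟩ => by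
    by_contra hyΩ
    have hym := hm y (hΩ.frontier_eq ▸ ⟨hy, hyΩ⟩)
    linarith [show m + γ ≤ z y from hzy]
  obtain ⟨G, hG, hGK⟩ := H.exists_contDiff_approx hΩ (hz.mono subset_closure) hch hK hKΩ hγ
  have hxK : x ∈ K := ⟨hx, mem_preimage.2 (mem_Ici.2 (by linarith))⟩
  obtain ⟨y, hyK, hymax⟩ := hK.exists_isMaxOn ⟨x, hxK⟩ hG.continuous.continuousOn
  have hzy : m + γ < z y := by
    have hxy : G x ≤ G y := hymax hxK
    linarith [abs_le.1 (hGK x hxK).1, abs_le.1 (hGK y hyK).1]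
  have hnhds : K ∈ 𝓝 y := by
    have hzy_cont : ContinuousAt z y :=
      (hz.mono subset_closure).continuousAt (hΩ.mem_nhds (hKΩ hyK))
    filter_upwards [hΩ.mem_nhds (hKΩ hyK), hzy_cont.eventually (lt_mem_nhds hzy)] with w hw hzw
      using ⟨subset_closure hw, hzw.le⟩
  linarith [(hGK y hyK).2,
    laplacian_nonpos_of_isLocalMax hG.contDiffAt (hymax.isLocalMax hnhds)]

theorem add_smul_norm_sq (H : HasWeakLaplacian Ω z h) (hΩ : IsOpen Ω) (a : ℝ) :
    HasWeakLaplacian Ω (z + a • fun y => ‖y‖ ^ 2)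
      (h + fun _ => a * (2 * Module.finrank ℝ F)) := by
  have hq : ContDiff ℝ 2 (a • fun y : F => ‖y‖ ^ 2) := contDiff_const.smul (contDiff_norm_sq ℝ)
  convert H.add (of_contDiffOn hΩ hq.contDiffOn) using 2
  ext y
  rw [InnerProductSpace.laplacian_smul a (contDiff_norm_sq ℝ).contDiffAt, laplacian_norm_sq,
    smul_eq_mul]

/- The barrier `ε‖·‖²` makes the Laplacian positive. -/
theorem le_of_forall_frontier_le [Nontrivial F] (H : HasWeakLaplacian Ω z h) (hΩ : IsOpen Ω)
    (hΩb : Bornology.IsBounded Ω) (hz : ContinuousOn z (closure Ω))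
    (hh : ∀ᵐ y ∂volume.restrict Ω, 0 ≤ h y) (hm : ∀ y ∈ frontier Ω, z y ≤ m)
    (hx : x ∈ closure Ω) : z x ≤ m := by
  obtain ⟨R, hR⟩ := hΩb.closure.subset_closedBall 0
  have hbarrier : ∀ ε > 0, z x ≤ m + ε * R ^ 2 := fun ε hε => by
    have hdim : (0 : ℝ) < Module.finrank ℝ F := Nat.cast_pos.2 Module.finrank_pos
    have hle : z x + ε * ‖x‖ ^ 2 ≤ m + ε * R ^ 2 :=
      (H.add_smul_norm_sq hΩ ε).le_of_forall_frontier_le_of_pos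
        (c := ε * (2 * Module.finrank ℝ F)) hΩ hΩb
        (hz.add (continuous_norm.pow 2 |>.const_smul ε).continuousOn) (by positivity)
        (hh.mono fun y hy => le_add_of_nonneg_left hy) (fun y hy => by
          have hyR : ‖y‖ ≤ R := mem_closedBall_zero_iff.1 (hR (frontier_subset_closure hy))
          exact add_le_add (hm y hy) (by dsimp; gcongr)) hx
    exact (le_add_of_nonneg_right (by positivity)).trans hle
  have hlim : Tendsto (fun ε : ℝ => m + ε * R ^ 2) (𝓝[>] 0) (𝓝 m) := by
    have hcont : Continuous fun ε : ℝ => m + ε * R ^ 2 := by fun_prop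
    simpa using (hcont.tendsto 0).mono_left nhdsWithin_le_nhds
  exact ge_of_tendsto hlim (eventually_mem_nhdsWithin.mono hbarrier)

theorem le_of_forall_frontier_le_of_neg_le [Nontrivial F] (H : HasWeakLaplacian Ω z h)
    (hΩ : IsOpen Ω) (hR : Ω ⊆ closedBall 0 R) (hz : ContinuousOn z (closure Ω)) (hK : 0 ≤ K)
    (hh : ∀ᵐ y ∂volume.restrict Ω, -K ≤ h y) (hm : ∀ y ∈ frontier Ω, z y ≤ K)
    (hx : x ∈ closure Ω) : z x ≤ K * (1 + R ^ 2) := by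
  have hdim : (1 : ℝ) ≤ Module.finrank ℝ F := Nat.one_le_cast.2 Module.finrank_pos
  have hle : z x + K * ‖x‖ ^ 2 ≤ K * (1 + R ^ 2) :=
    (H.add_smul_norm_sq hΩ K).le_of_forall_frontier_le hΩ (isBounded_closedBall.subset hR)
      (hz.add (continuous_norm.pow 2 |>.const_smul K).continuousOn)
      (hh.mono fun y hy => by
        dsimp
        nlinarith) (fun y hy => by
        have hyR : ‖y‖ ≤ R := mem_closedBall_zero_iff.1
          (closure_minimal hR isClosed_closedBall (frontier_subset_closure hy))
        rw [mul_add, mul_one]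
        exact add_le_add (hm y hy) (by dsimp; gcongr)) hx
  exact (le_add_of_nonneg_right (by positivity)).trans hle

theorem abs_le_of_forall_frontier_abs_le [Nontrivial F] (H : HasWeakLaplacian Ω z h)
    (hΩ : IsOpen Ω) (hR : Ω ⊆ closedBall 0 R) (hz : ContinuousOn z (closure Ω)) (hK : 0 ≤ K)
    (hh : ∀ᵐ y ∂volume.restrict Ω, |h y| ≤ K) (hm : ∀ y ∈ frontier Ω, |z y| ≤ K)
    (hx : x ∈ closure Ω) : |z x| ≤ K * (1 + R ^ 2) := by
  refine abs_le'.2 ⟨?_, ?_⟩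
  · refine H.le_of_forall_frontier_le_of_neg_le hΩ hR hz hK ?_
      (fun y hy => (abs_le.1 (hm y hy)).2) hx
    filter_upwards [hh] with y hy using (abs_le.1 hy).1
  · refine H.neg.le_of_forall_frontier_le_of_neg_le hΩ hR hz.neg hK ?_
      (fun y hy => neg_le.1 (abs_le.1 (hm y hy)).1) hx
    filter_upwards [hh] with y hy using neg_le_neg (abs_le.1 hy).2

end HasWeakLaplacian

end MaximumPrinciple

section Poisson

variable {d : ℕ} {Ω : Set (E d)} {f g u v : E d → ℝ}

theorem hasWeakLaplacian_of_isWeakDeriv {D : Fin d → E d → ℝ}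
    (hu : LocallyIntegrableOn u Ω) (hD : ∀ i, IsWeakDeriv Ω u ![i, i] (D i)) :
    HasWeakLaplacian Ω u (∑ i, D i) where
  locallyIntegrableOn_left := hu
  locallyIntegrableOn_right :=
    Finset.sum_induction D (LocallyIntegrableOn · Ω) (fun _ _ => LocallyIntegrableOn.add)
      (fun _ _ => ⟨Ω, self_mem_nhdsWithin, integrableOn_zero⟩) fun i _ => (hD i).1
  integral_eq η hη hηc hηs := by
    have hη₂ : ContDiff ℝ 2 η := contDiff_infty.1 hη 2
    let e := EuclideanSpace.basisFun (Fin d) ℝ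
    have hη' (i) : ContDiff ℝ 1 fun y => fderiv ℝ η y (e i) :=
      (hη₂.fderiv_right (by norm_num)).clm_apply contDiff_const
    have hsupp (i) : tsupport (fun x => fderiv ℝ (fun y => fderiv ℝ η y (e i)) x (e i)) ⊆ Ω :=
      ((tsupport_fderiv_apply_subset ℝ (e i)).trans
        (tsupport_fderiv_apply_subset ℝ (e i))).trans hηs
    have hterm (i) : ∫ x, u x * fderiv ℝ (fun y => fderiv ℝ η y (e i)) x (e i) =
        ∫ x, D i x * η x := by
      rw [← setIntegral_eq_integral_of_forall_compl_eq_zero (s := Ω) fun x hx =>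
          mul_eq_zero_of_right (u x) (image_eq_zero_of_notMem_tsupport fun h => hx (hsupp i h)),
        ← setIntegral_eq_integral_of_forall_compl_eq_zero (s := Ω) fun x hx =>
          mul_eq_zero_of_right (D i x) (image_eq_zero_of_notMem_tsupport fun h => hx (hηs h))]
      simpa [iteratedFDeriv_two_apply, fderiv_fderiv_apply hη₂.contDiffAt, e]
        using (hD i).2 η ⟨hη, hηc, hηs⟩
    simp only [laplacian_eq_sum_fderiv_fderiv hη₂.contDiffAt e, Finset.mul_sum, Finset.sum_apply,
      Finset.sum_mul]
    rw [integral_finsetSum, integral_finsetSum]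
    · exact Finset.sum_congr rfl fun i _ => hterm i
    · exact fun i _ => integrable_mul_of_tsupport_subset (hD i).1 hη.continuous hηc hηs
    · exact fun i _ => integrable_mul_of_tsupport_subset hu
        (((hη' i).continuous_fderiv one_ne_zero).clm_apply continuous_const)
        ((hηc.fderiv_apply ℝ (e i)).fderiv_apply ℝ (e i)) (hsupp i)

theorem enorm_le_supNorm (v : E d → ℝ) {x : E d} (hx : x ∈ closure Ω) : ‖v x‖ₑ ≤ supNorm Ω v :=
  le_iSup₂_of_le x hx le_rfl

theorem SolvesPoisson.enorm_sub_le {R : ℝ} {x : E d} (hu : SolvesPoisson Ω f g u) (hd : 0 < d)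
    (hΩ : IsOpen Ω) (hR : Ω ⊆ closedBall 0 R) (hv : ∀ y ∈ closure Ω, ContDiffAt ℝ 2 v y)
    (hx : x ∈ closure Ω) :
    ‖v x - u x‖ₑ ≤ ENNReal.ofReal (1 + R ^ 2) * supNorm Ω (calL Ω v - data Ω f g) := by
  set T := supNorm Ω (calL Ω v - data Ω f g)
  have hC : 0 < 1 + R ^ 2 := by positivity
  rcases eq_or_ne T ⊤ with hT | hT
  · simp [hT, ENNReal.mul_top, hC]
  have hres {y} (hy : y ∈ closure Ω) : |calL Ω v y - data Ω f g y| ≤ T.toReal := by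
    simpa using ENNReal.toReal_mono hT (enorm_le_supNorm (calL Ω v - data Ω f g) hy)
  have : Nonempty (Fin d) := ⟨⟨0, hd⟩⟩
  obtain ⟨D, hD, hpde⟩ := hu.pde
  have huΩ : ContinuousOn u Ω := hu.continuousOn.mono subset_closure
  have hv_weak : HasWeakLaplacian Ω v (Δ v) := .of_contDiffOn hΩ fun y hy =>
    (hv y (subset_closure hy)).contDiffWithinAt
  have hu_weak : HasWeakLaplacian Ω u (∑ i, D i) :=
    hasWeakLaplacian_of_isWeakDeriv (huΩ.locallyIntegrableOn hΩ.measurableSet) hD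
  have habs := (hv_weak.sub hu_weak).abs_le_of_forall_frontier_abs_le (K := T.toReal) hΩ hR
    (ContinuousOn.sub (fun y hy => (hv y hy).continuousAt.continuousWithinAt) hu.continuousOn)
    ENNReal.toReal_nonneg ?_ (fun y hy => ?_) hx
  · rw [← ENNReal.ofReal_toReal hT, ← ENNReal.ofReal_mul hC.le, mul_comm, Real.enorm_eq_ofReal_abs]
    exact ENNReal.ofReal_le_ofReal habs
  · filter_upwards [hpde, ae_restrict_mem hΩ.measurableSet] with y hy hyΩ
    have hyres := hres (subset_closure hyΩ)
    rw [calL, data, if_pos hyΩ, if_pos hyΩ, ← hy, ← neg_sub', abs_neg] at hyres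
    simpa using hyres
  · have hyres := hres (frontier_subset_closure hy)
    have hyΩ : y ∉ Ω := (hΩ.frontier_eq ▸ hy).2
    rwa [calL, data, if_neg hyΩ, if_neg hyΩ, ← hu.boundary y hy] at hyres

theorem exists_eLpNorm_sub_le_supNorm (hd : 0 < d) (hΩ : IsOpen Ω)
    (hΩb : Bornology.IsBounded Ω) (p : ℝ≥0∞) :
    ∃ C : ℝ≥0, ∀ {f g u v : E d → ℝ}, SolvesPoisson Ω f g u →
      (∀ y ∈ closure Ω, ContDiffAt ℝ 2 v y) →
      eLpNorm (v - u) p (volume.restrict Ω) ≤ C * supNorm Ω (calL Ω v - data Ω f g) := by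
  obtain ⟨R, hR⟩ := hΩb.subset_closedBall 0
  let C : ℝ≥0∞ := volume Ω ^ p.toReal⁻¹ * ENNReal.ofReal (1 + R ^ 2)
  have hC : C ≠ ⊤ := ENNReal.mul_ne_top
    (ENNReal.rpow_ne_top_of_nonneg (by positivity) hΩb.measure_lt_top.ne) ENNReal.ofReal_ne_top
  refine ⟨C.toNNReal, fun {f g u v} hu hv => ?_⟩
  have hle : ∀ᵐ x ∂volume.restrict Ω, ‖(v - u) x‖ₑ ≤
      ENNReal.ofReal (1 + R ^ 2) * supNorm Ω (calL Ω v - data Ω f g) :=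
    (ae_restrict_mem hΩ.measurableSet).mono fun x hx =>
      hu.enorm_sub_le hd hΩ hR hv (subset_closure hx)
  refine (eLpNorm_le_of_ae_enorm_bound hle).trans_eq ?_
  rw [ENNReal.coe_toNNReal hC, Measure.restrict_apply_univ, smul_eq_mul]
  ring

end Poisson

section LinearAlgebra

variable {M N : ℕ} {A : Matrix (Fin M) (Fin N) ℝ} {r : Fin M → ℝ} {τ : ℝ}

open scoped Matrix.Norms.Operator in
theorem norm_mulVec_le_rowSumNorm (A : Matrix (Fin M) (Fin N) ℝ) (v : Fin N → ℝ) :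
    ‖A *ᵥ v‖ ≤ rowSumNorm A * ‖v‖ := by
  have h := linfty_opNNNorm_mulVec A v
  rwa [linfty_opNNNorm_def] at h

theorem isUnit_det_transpose_mul_self_of_rank_eq (hA : A.rank = N) : IsUnit (Aᵀ * A).det := by
  rw [← isUnit_iff_isUnit_det, ← linearIndependent_cols_iff_isUnit,
    linearIndependent_iff_card_eq_finrank_span, Set.finrank, ← rank_eq_finrank_span_cols,
    rank_transpose_mul_self, hA, Fintype.card_fin]

theorem orthogonalUpTo_of_norm_le (hr : ‖r‖ ≤ τ) : OrthogonalUpTo A r τ :=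
  ⟨r, hr, by rw [sub_self, mulVec_zero]⟩

theorem orthogonalUpTo_of_norm_transpose_mulVec_le (hA : A.rank = N) (hr : ‖Aᵀ *ᵥ r‖ ≤ τ) :
    OrthogonalUpTo A r (rowSumNorm (A * (Aᵀ * A)⁻¹) * τ) := by
  refine ⟨(A * (Aᵀ * A)⁻¹) *ᵥ (Aᵀ *ᵥ r), (norm_mulVec_le_rowSumNorm _ _).trans (by gcongr), ?_⟩
  rw [mulVec_sub, mulVec_mulVec _ Aᵀ (A * _), ← Matrix.mul_assoc,
    mul_nonsing_inv _ (isUnit_det_transpose_mul_self_of_rank_eq hA), one_mulVec, sub_self]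

end LinearAlgebra

section PoissonOperator

variable {d : ℕ} {Ω : Set (E d)} {x : E d}

theorem calL_sum {ι : Type*} {s : Finset ι} {v : ι → E d → ℝ}
    (hv : ∀ i ∈ s, ContDiffAt ℝ 2 (v i) x) :
    calL Ω (∑ i ∈ s, v i) x = ∑ i ∈ s, calL Ω (v i) x := by
  unfold calL
  split_ifs
  · rw [laplacian_sum hv, Finset.sum_neg_distrib]
  · exact Finset.sum_apply x s v

theorem calL_smul (c : ℝ) {v : E d → ℝ} (hv : ContDiffAt ℝ 2 v x) :
    calL Ω (c • v) x = c * calL Ω v x := by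
  unfold calL
  split_ifs
  · rw [InnerProductSpace.laplacian_smul c hv, smul_eq_mul, mul_neg]
  · rfl

end PoissonOperator

namespace Scheme

variable {d P N M : ℕ} {Ω : Set (E d)} (S : Scheme d P N M Ω) {f g u : E d → ℝ} {x : E d}

theorem contDiff_psi (j : Fin P) (k : S.J j) : ContDiff ℝ 2 fun y => S.psi j y k :=
  ContDiff.sum fun i _ =>
    (S.contDiff_phi.comp (contDiff_id.sub (contDiff_const (c := S.X i)))).mul contDiff_const

theorem contDiffAt_w_mul_psi (j : Fin P) (k : S.J j) (hx : x ∈ closure Ω) :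
    ContDiffAt ℝ 2 (fun y => S.w j y * S.psi j y k) x :=
  ((S.contDiffOn_w j).contDiffAt ((isOpen_iUnion S.isOpen_patch).mem_nhds (S.cover hx))).mul
    (S.contDiff_psi j k).contDiffAt

theorem approx_eq_sum_smul (V : Fin N → ℝ) :
    S.approx V = ∑ p : (j : Fin P) × S.J j, V p.2 • fun y => S.w p.1 y * S.psi p.1 y p.2 := by
  funext y
  simp only [approx, localApprox, Fintype.sum_sigma, Finset.sum_apply, Finset.mul_sum,
    Pi.smul_apply, smul_eq_mul]
  refine Finset.sum_congr rfl fun j _ => Finset.sum_congr rfl fun k _ => ?_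
  ring

theorem contDiffAt_approx (V : Fin N → ℝ) (hx : x ∈ closure Ω) :
    ContDiffAt ℝ 2 (S.approx V) x := by
  rw [approx_eq_sum_smul, Finset.sum_fn]
  exact ContDiffAt.sum fun p _ => contDiffAt_const.smul (S.contDiffAt_w_mul_psi p.1 p.2 hx)

theorem Lrow_dotProduct (x : E d) (V : Fin N → ℝ) :
    S.Lrow x ⬝ᵥ V =
      ∑ p : (j : Fin P) × S.J j, V p.2 * calL Ω (fun y => S.w p.1 y * S.psi p.1 y p.2) x := by
  simp only [dotProduct, Lrow, Finset.sum_mul, Fintype.sum_sigma]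
  rw [Finset.sum_comm]
  refine Finset.sum_congr rfl fun j _ => ?_
  rw [← Finset.sum_subset (Finset.subset_univ (S.J j)) fun k _ hk => by rw [dif_neg hk, zero_mul],
    ← Finset.sum_coe_sort (S.J j)]
  exact Finset.sum_congr rfl fun k _ => by rw [dif_pos k.2, mul_comm]

theorem calL_approx (V : Fin N → ℝ) (hx : x ∈ closure Ω) :
    calL Ω (S.approx V) x = S.Lrow x ⬝ᵥ V := by
  have hbasis (p : (j : Fin P) × S.J j) := S.contDiffAt_w_mul_psi p.1 p.2 hx
  have hsmul (p : (j : Fin P) × S.J j) :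
      ContDiffAt ℝ 2 (V p.2 • fun y => S.w p.1 y * S.psi p.1 y p.2) x :=
    contDiffAt_const.smul (hbasis p)
  rw [approx_eq_sum_smul, calL_sum fun p _ => hsmul p, Lrow_dotProduct]
  exact Finset.sum_congr rfl fun p _ => calL_smul _ (hbasis p)

theorem L_mulVec (V : Fin N → ℝ) : S.L *ᵥ V = fun i => calL Ω (S.approx V) (S.Y i) :=
  funext fun i => (S.calL_approx V (S.Y_mem i)).symm

theorem Lplus_mul_L (hL : S.L.rank = N) : S.Lplus * S.L = 1 := by
  rw [Lplus, Matrix.mul_assoc, nonsing_inv_mul _ (isUnit_det_transpose_mul_self_of_rank_eq hL)]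

theorem Lplus_mulVec_residual {U : Fin N → ℝ} {e : Fin M → ℝ}
    (he : S.Lᵀ *ᵥ (S.residual f g U - e) = 0) :
    S.Lplus *ᵥ S.residual f g U = S.Lplus *ᵥ e := by
  rw [← sub_eq_zero, ← mulVec_sub, Lplus, ← mulVec_mulVec, he, mulVec_zero]

/- The residuals of `U` and of the nodal values `V` of `u` differ by `L (U - V)`, so `L⁺` recovers
`U - V` from them. -/
theorem calL_approx_sub_data (hL : S.L.rank = N) {U : Fin N → ℝ} {e : Fin M → ℝ}
    (he : S.Lᵀ *ᵥ (S.residual f g U - e) = 0) (hx : x ∈ closure Ω) :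
    calL Ω (S.approx U) x - data Ω f g x = S.interpError f g u x +
      (S.Lrow x ᵥ* S.Lplus) ⬝ᵥ (e - fun i => S.interpError f g u (S.Y i)) := by
  let V : Fin N → ℝ := fun k => u (S.X k)
  have hres : S.residual f g U - (fun i => S.interpError f g u (S.Y i)) = S.L *ᵥ (U - V) := by
    rw [mulVec_sub, S.L_mulVec V]
    exact funext fun i => sub_sub_sub_cancel_right _ _ _
  have hUV : S.Lplus *ᵥ (e - fun i => S.interpError f g u (S.Y i)) = U - V := by
    rw [mulVec_sub, ← S.Lplus_mulVec_residual he, ← mulVec_sub, hres, mulVec_mulVec,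
      S.Lplus_mul_L hL, one_mulVec]
  rw [← dotProduct_mulVec, hUV, dotProduct_sub, ← S.calL_approx U hx, ← S.calL_approx V hx]
  change _ = calL Ω (S.approx V) x - data Ω f g x + _
  ring

theorem enorm_Lrow_vecMul_Lplus_dotProduct_le {r : Fin M → ℝ} {B : ℝ≥0∞} (hx : x ∈ closure Ω)
    (hr : ∀ i, ‖r i‖ₑ ≤ B) : ‖(S.Lrow x ᵥ* S.Lplus) ⬝ᵥ r‖ₑ ≤ S.stabilityNorm * B :=
  calc ‖(S.Lrow x ᵥ* S.Lplus) ⬝ᵥ r‖ₑ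
      ≤ ∑ i, ‖(S.Lrow x ᵥ* S.Lplus) i * r i‖ₑ := enorm_sum_le _ _
    _ ≤ ∑ i, ‖(S.Lrow x ᵥ* S.Lplus) i‖ₑ * B := by
        simp only [enorm_mul]
        gcongr with i
        exact hr i
    _ = (∑ i, ‖(S.Lrow x ᵥ* S.Lplus) i‖ₑ) * B := (Finset.sum_mul _ _ _).symm
    _ ≤ S.stabilityNorm * B := by
        gcongr
        exact le_iSup₂_of_le (f := fun y _ => ∑ i, ‖(S.Lrow y ᵥ* S.Lplus) i‖ₑ) x hx le_rfl

theorem supNorm_calL_approx_sub_data_le (u : E d → ℝ) (hL : S.L.rank = N) {U : Fin N → ℝ} {τ : ℝ}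
    (hU : OrthogonalUpTo S.L (S.residual f g U) τ) :
    supNorm Ω (calL Ω (S.approx U) - data Ω f g) ≤ supNorm Ω (S.interpError f g u) +
      S.stabilityNorm * (ENNReal.ofReal τ + supNorm Ω (S.interpError f g u)) := by
  obtain ⟨e, heτ, he⟩ := hU
  refine iSup₂_le fun x hx => ?_
  rw [Pi.sub_apply, S.calL_approx_sub_data (u := u) hL he hx]
  refine (enorm_add_le _ _).trans (add_le_add (enorm_le_supNorm _ hx)
    (S.enorm_Lrow_vecMul_Lplus_dotProduct_le hx fun i => ?_))
  refine enorm_sub_le.trans (add_le_add ?_ (enorm_le_supNorm _ (S.Y_mem i)))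
  rw [← ofReal_norm]
  exact ENNReal.ofReal_le_ofReal ((norm_le_pi_norm e i).trans heτ)

end Scheme

theorem exists_eLpNorm_approx_sub_le_errorBound {d : ℕ} {Ω : Set (E d)} (hd : 0 < d)
    (hΩ : IsOpen Ω) (hΩb : Bornology.IsBounded Ω) (p : ℝ≥0∞) :
    ∃ CP : ℝ≥0, ∀ {f g u : E d → ℝ}, SolvesPoisson Ω f g u →
      ∀ {P N M : ℕ} (S : Scheme d P N M Ω), S.L.rank = N → ∀ {U : Fin N → ℝ} {τ : ℝ},
        OrthogonalUpTo S.L (S.residual f g U) τ →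
          eLpNorm (S.approx U - u) p (volume.restrict Ω) ≤ S.errorBound CP f g u τ := by
  obtain ⟨CP, hCP⟩ := exists_eLpNorm_sub_le_supNorm hd hΩ hΩb p
  refine ⟨CP, fun {f g u} hu {P N M} S hL {U τ} hU => ?_⟩
  calc eLpNorm (S.approx U - u) p (volume.restrict Ω)
      ≤ CP * supNorm Ω (calL Ω (S.approx U) - data Ω f g) :=
        hCP hu fun _ => S.contDiffAt_approx U
    _ ≤ CP * (supNorm Ω (S.interpError f g u) +
          S.stabilityNorm * (ENNReal.ofReal τ + supNorm Ω (S.interpError f g u))) := by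
        gcongr
        exact S.supNorm_calL_approx_sub_data_le u hL hU
    _ = S.errorBound CP f g u τ := by rw [Scheme.errorBound, mul_add, mul_assoc]

end RBFPUM

theorem mainTheorem1_general (d : ℕ) (hd : 0 < d) (Ω : Set (RBFPUM.E d)) (hΩ : IsOpen Ω)
    (hΩb : Bornology.IsBounded Ω) (p : ℝ≥0∞) :
    ∃ CP : ℝ≥0, ∀ f g u : RBFPUM.E d → ℝ, RBFPUM.SolvesPoisson Ω f g u →
      ∀ (P N M : ℕ) (S : RBFPUM.Scheme d P N M Ω), S.L.rank = N →
      ∀ (U : Fin N → ℝ) (τ : ℝ),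
        (‖S.residual f g U‖ ≤ τ →
          eLpNorm (S.approx U - u) p (volume.restrict Ω) ≤ S.errorBound CP f g u τ) ∧
        (RBFPUM.OrthogonalUpTo S.L (S.residual f g U) τ →
          eLpNorm (S.approx U - u) p (volume.restrict Ω) ≤ S.errorBound CP f g u τ) ∧
        (‖S.Lᵀ *ᵥ S.residual f g U‖ ≤ τ →
          eLpNorm (S.approx U - u) p (volume.restrict Ω) ≤
            S.errorBound CP f g u (RBFPUM.rowSumNorm (S.L * (S.Lᵀ * S.L)⁻¹) * τ)) := by
  obtain ⟨CP, hCP⟩ := RBFPUM.exists_eLpNorm_approx_sub_le_errorBound hd hΩ hΩb p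
  exact ⟨CP, fun f g u hu P N M S hL U τ =>
    ⟨fun h => hCP hu S hL (RBFPUM.orthogonalUpTo_of_norm_le h), hCP hu S hL,
      fun h => hCP hu S hL (RBFPUM.orthogonalUpTo_of_norm_transpose_mulVec_le hL h)⟩⟩

theorem mainTheorem1 (d : ℕ) (hd : 0 < d) (Ω : Set (RBFPUM.E d)) (hΩ : IsOpen Ω)
    (hΩb : Bornology.IsBounded Ω) :
    ∃ CP : ℝ≥0, ∀ (m : ℕ) (f g u : RBFPUM.E d → ℝ), 2 ≤ m →
      RBFPUM.MemSobolev m ∞ Ω u → RBFPUM.SolvesPoisson Ω f g u →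
      ∀ (P N M : ℕ) (S : RBFPUM.Scheme d P N M Ω), S.L.rank = N →
      ∀ (U : Fin N → ℝ) (CM δM : ℝ),
        -- collocation: the residual is of the size of the rounding error
        (S.IsCollocation → ‖S.residual f g U‖ ≤ CM * δM →
          eLpNorm (fun x => S.approx U x - u x) 2 (volume.restrict Ω) ≤
            S.errorBound CP f g u (CM * δM)) ∧
        -- least squares: the residual is orthogonal to the columns up to the rounding error
        (S.IsLeastSquares → RBFPUM.OrthogonalUpTo S.L (S.residual f g U) (CM * δM) →
          eLpNorm (fun x => S.approx U x - u x) 2 (volume.restrict Ω) ≤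
            S.errorBound CP f g u (CM * δM)) ∧
        -- least squares, with the rounding error measured in the product `Lᵀ r`
        (S.IsLeastSquares → ‖S.Lᵀ *ᵥ S.residual f g U‖ ≤ CM * δM →
          eLpNorm (fun x => S.approx U x - u x) 2 (volume.restrict Ω) ≤
            S.errorBound CP f g u
              (RBFPUM.rowSumNorm (S.L * (S.Lᵀ * S.L)⁻¹) * CM * δM)) := by
  obtain ⟨CP, hCP⟩ := mainTheorem1_general d hd Ω hΩ hΩb 2
  refine ⟨CP, fun _ f g u _ _ hu P N M S hL U CM δM => ?_⟩
  obtain ⟨hres, horth, hprod⟩ := hCP f g u hu P N M S hL U (CM * δM)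
  exact ⟨fun _ => hres, fun _ => horth, fun _ => mul_assoc _ CM δM ▸ hprod⟩
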